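/- Let $A\to M$ be a smooth real vector bundle of finite rank over a (Hausdorff, finite-dimensional) smooth manifold $M$, equipped with a Lie algebroid structure $\mu$, i.e. a smooth bundle map $\rho:A\to TM$ (the anchor) and a real Lie bracket $[\cdot,\cdot]$ on $\Gamma(A)$ with $[X,fY]=f[X,Y]+(\rho(X)f)\,Y$ for $X,Y\in\Gamma(A)$, $f\in C^\infty(M)$; let $\mathrm d$ be the associated Lie algebroid differential on $\Gamma(\wedge^\bullet A^*)$. Indices below are taken in $\mathbb Z/3\mathbb Z$, with representatives $1,2,3$. Let $\omega_1,\omega_2,\omega_3\in\Gamma(\wedge^2A^*)$ be non-degenerate $2$-forms, with $\omega_i^\flat:A\to A^*$, $\langle\omega_i^\flat(X),Y\rangle=\omega_i(X,Y)$, and inverse bivectors $\pi_i\in\Gamma(\wedge^2A)$, where $\pi_i^\sharp:A^*\to A$, $\langle\beta,\pi_i^\sharp(\alpha)\rangle=\pi_i(\alpha,\beta)$, satisfies $\pi_i^\sharp=(\omega_i^\flat)^{-1}$. Define the transition morphisms $$N_i:=\pi_{i-1}^\sharp\circ\omega_{i+1}^\flat:A\to A,\qquad i\in\mathbb Z/3\mathbb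 Z,$$ and write $N_i\mathrm d\omega_i(X,Y,Z):=\mathrm d\omega_i(N_iX,N_iY,N_iZ)$. Suppose that $(\omega_1,\omega_2,\omega_3)$ is a hypersymplectic or a para-hypersymplectic structure with torsion on $(A,\mu)$, that is, there are signs $\varepsilon_1,\varepsilon_2,\varepsilon_3\in\{1,-1\}$ with $\varepsilon_1\varepsilon_2\varepsilon_3=-1$ such that $$N_i^2=\varepsilon_i\,\mathrm{id}_A\quad(i=1,2,3)\qquad\text{and}\qquad \varepsilon_2\,N_1\mathrm d\omega_1=\varepsilon_3\,N_2\mathrm d\omega_2=\varepsilon_1\,N_3\mathrm d\omega_3$$ (the hypersymplectic case is $\varepsilon_1=\varepsilon_2=\varepsilon_3=-1$, the para-hypersymplectic case is any other choice). Then $N_1,N_2,N_3$ are Nijenhuis morphisms: for each $i$ the Nijenhuis torsion vanishes, i.e. $$[N_iX,N_iY]-N_i\big([N_iX,Y]+[X,N_iY]-N_i[X,Y]\big)=0\qquad\text{for all }X,Y\in\Gamma(A).$$ -/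

import Mathlib

open Bundle Manifold ContDiff

namespace HSTorsion

noncomputable section

variable {E : Type*} [NormedAddCommGroup E] [NormedSpace ℝ E] {H : Type*} [TopologicalSpace H]
  (I : ModelWithCorners ℝ E H) {M : Type*} [TopologicalSpace M] [ChartedSpace H M]
  (F : Type*) [NormedAddCommGroup F] [NormedSpace ℝ F]
  (V : M → Type*) [TopologicalSpace (TotalSpace F V)]
  [∀ x, AddCommGroup (V x)] [∀ x, Module ℝ (V x)] [∀ x, TopologicalSpace (V x)]
  [FiberBundle F V] [VectorBundle ℝ F V]

section Algebroid

variable {I F V} in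
/-- The product `f • Y` of a smooth function and a smooth section. -/
def smulSection (f : C^∞⟮I, M; ℝ⟯) (Y : Cₛ^∞⟮I; F, V⟯) : Cₛ^∞⟮I; F, V⟯ :=
  ⟨fun x => f x • Y x, f.contMDiff.smul_section Y.contMDiff⟩

/-- A Lie algebroid structure on the smooth real vector bundle `V → M`: a smooth bundle map
`anchor : V → TM` over the identity and a real Lie bracket on the smooth sections of `V` such that
`[X, f Y] = f [X, Y] + (anchor(X) f) Y`. -/
structure LieAlgebroid [IsManifold I ∞ M] where
  /-- The anchor map. -/
  anchor : ∀ x : M, V x →L[ℝ] TangentSpace I x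
  contMDiff_anchor : ContMDiff (I.prod 𝓘(ℝ, F)) I.tangent ∞
    (fun v : TotalSpace F V => (⟨v.proj, anchor v.proj v.snd⟩ : TangentBundle I M))
  /-- The bracket of sections. -/
  bracket : Cₛ^∞⟮I; F, V⟯ →ₗ[ℝ] Cₛ^∞⟮I; F, V⟯ →ₗ[ℝ] Cₛ^∞⟮I; F, V⟯
  bracket_self : ∀ X, bracket X X = 0
  jacobi : ∀ X Y Z,
    bracket X (bracket Y Z) + bracket Y (bracket Z X) + bracket Z (bracket X Y) = 0
  leibniz : ∀ (X Y : Cₛ^∞⟮I; F, V⟯) (f : C^∞⟮I, M; ℝ⟯) (x : M),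
    bracket X (smulSection f Y) x =
      f x • bracket X Y x + (show ℝ from mfderiv I 𝓘(ℝ, ℝ) f x (anchor x (X x))) • Y x

/-- A smooth endomorphism of the vector bundle `V`, over the identity of `M`. -/
structure BundleEnd where
  /-- The endomorphism of each fibre. -/
  toFun : ∀ x : M, V x →L[ℝ] V x
  contMDiff_toFun : ContMDiff (I.prod 𝓘(ℝ, F)) (I.prod 𝓘(ℝ, F)) ∞
    (fun v : TotalSpace F V => (⟨v.proj, toFun v.proj v.snd⟩ : TotalSpace F V))

variable {I F V}

/-- The section `x ↦ N (X x)`. -/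
def BundleEnd.onSection (N : BundleEnd I F V) (X : Cₛ^∞⟮I; F, V⟯) : Cₛ^∞⟮I; F, V⟯ :=
  ⟨fun x => N.toFun x (X x), N.contMDiff_toFun.comp X.contMDiff⟩

variable [IsManifold I ∞ M]

/-- The function `anchor(X) f`. -/
def LieAlgebroid.deriv (A : LieAlgebroid I F V) (X : Cₛ^∞⟮I; F, V⟯) (f : M → ℝ) (x : M) : ℝ :=
  mfderiv I 𝓘(ℝ, ℝ) f x (A.anchor x (X x))

/-- The Nijenhuis torsion `[NX, NY] - N([NX, Y] + [X, NY] - N[X, Y])` of a bundle endomorphism. -/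
def LieAlgebroid.torsion (A : LieAlgebroid I F V) (N : BundleEnd I F V)
    (X Y : Cₛ^∞⟮I; F, V⟯) : Cₛ^∞⟮I; F, V⟯ :=
  A.bracket (N.onSection X) (N.onSection Y) -
    N.onSection (A.bracket (N.onSection X) Y + A.bracket X (N.onSection Y) -
      N.onSection (A.bracket X Y))

/-- `N` is a Nijenhuis morphism: its Nijenhuis torsion vanishes. -/
def LieAlgebroid.IsNijenhuis (A : LieAlgebroid I F V) (N : BundleEnd I F V) : Prop :=
  ∀ X Y, A.torsion N X Y = 0

end Algebroid

section Forms

set_option linter.unusedSectionVars false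

variable [∀ x, IsTopologicalAddGroup (V x)] [∀ x, ContinuousSMul ℝ (V x)]

/-- A smooth section of the second exterior power of the dual bundle `V*`. The map `σ^♭ : V → V*`
is `X ↦ σ(X, ·)`, i.e. `toFun x` itself. -/
structure TwoForm where
  /-- The bilinear form on each fibre. -/
  toFun : ∀ x : M, V x →L[ℝ] V x →L[ℝ] ℝ
  skew : ∀ x v w, toFun x v w = -toFun x w v
  contMDiff_toFun : ContMDiff I (I.prod 𝓘(ℝ, F →L[ℝ] F →L[ℝ] ℝ)) ∞
    (fun x => TotalSpace.mk' (F →L[ℝ] F →L[ℝ] ℝ) x (toFun x))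

/-- A non-degenerate 2-form. -/
structure NondegTwoForm extends TwoForm I F V where
  nondeg : ∀ x v, (∀ w, toFun x v w = 0) → v = 0

/-- A smooth section `π` of the second exterior power of `V`, given as the skew-symmetric bundle
map `π^♯ : V* → V`; as a bilinear form on `V*`, `π(α, β) = β (π^♯ α)`. -/
structure Bivector where
  /-- The map `π^♯` on each fibre. -/
  sharp : ∀ x : M, (V x →L[ℝ] ℝ) →L[ℝ] V x
  skew : ∀ x (α β : V x →L[ℝ] ℝ), β (sharp x α) = -α (sharp x β)
  contMDiff_sharp : ContMDiff (I.prod 𝓘(ℝ, F →L[ℝ] ℝ)) (I.prod 𝓘(ℝ, F)) ∞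
    (fun α : TotalSpace (F →L[ℝ] ℝ) (fun x => V x →L[ℝ] ℝ) =>
      (⟨α.proj, sharp α.proj α.snd⟩ : TotalSpace F V))

variable {I F V}

/-- The Lie algebroid differential of a 2-form, evaluated on three sections. -/
def TwoForm.d [IsManifold I ∞ M] (A : LieAlgebroid I F V) (σ : TwoForm I F V)
    (X Y Z : Cₛ^∞⟮I; F, V⟯) (x : M) : ℝ :=
  A.deriv X (fun y => σ.toFun y (Y y) (Z y)) x
    - A.deriv Y (fun y => σ.toFun y (X y) (Z y)) x
    + A.deriv Z (fun y => σ.toFun y (X y) (Y y)) x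
    - σ.toFun x (A.bracket X Y x) (Z x)
    + σ.toFun x (A.bracket X Z x) (Y x)
    - σ.toFun x (A.bracket Y Z x) (X x)

variable [FiniteDimensional ℝ F]

theorem NondegTwoForm.isInvertible (σ : NondegTwoForm I F V) (x : M) :
    (σ.toFun x).IsInvertible := by
  let e : V x ≃L[ℝ] F := (trivializationAt F V x).continuousLinearEquivAt ℝ x
    (FiberBundle.mem_baseSet_trivializationAt' x)
  have hfd : FiniteDimensional ℝ (V x) := e.symm.toLinearEquiv.finiteDimensional
  have hT2 : T2Space (V x) := e.toHomeomorph.symm.t2Space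
  let e' : (V x →L[ℝ] ℝ) ≃L[ℝ] (F →L[ℝ] ℝ) := e.arrowCongr (ContinuousLinearEquiv.refl ℝ ℝ)
  let g : F →L[ℝ] (F →L[ℝ] ℝ) := (e' : (V x →L[ℝ] ℝ) →L[ℝ] (F →L[ℝ] ℝ)) ∘L σ.toFun x ∘L
    (e.symm : F →L[ℝ] V x)
  have hinj : Function.Injective g := by
    have h1 : Function.Injective (σ.toFun x) := by
      rw [injective_iff_map_eq_zero]
      intro v hv
      exact σ.nondeg x v (fun w => by rw [hv]; rfl)
    exact e'.injective.comp (h1.comp e.symm.injective)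
  have hdim : Module.finrank ℝ F = Module.finrank ℝ (F →L[ℝ] ℝ) := by
    rw [← (LinearMap.toContinuousLinearMap (𝕜 := ℝ) (E := F) (F' := ℝ)).finrank_eq]
    exact (Subspace.dual_finrank_eq (K := ℝ) (V := F)).symm
  have hg : g.IsInvertible :=
    ⟨(LinearEquiv.ofInjectiveOfFinrankEq g.toLinearMap hinj hdim).toContinuousLinearEquiv, by
      ext; rfl⟩
  have : (σ.toFun x ∘L (e.symm : F →L[ℝ] V x)).IsInvertible :=
    ContinuousLinearMap.isInvertible_equiv_comp.1 hg
  exact ContinuousLinearMap.isInvertible_comp_equiv.1 this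

variable [ContMDiffVectorBundle ∞ F V I]

/-- The inverse bivector `π` of a non-degenerate 2-form `σ`: `π^♯ = (σ^♭)⁻¹`. -/
def NondegTwoForm.inv (σ : NondegTwoForm I F V) : Bivector I F V where
  sharp x := (σ.toFun x).inverse
  skew x α β := by
    have h := σ.isInvertible x
    have h1 := σ.skew x ((σ.toFun x).inverse β) ((σ.toFun x).inverse α)
    rwa [h.self_apply_inverse, h.self_apply_inverse] at h1
  contMDiff_sharp := by
    intro α₀
    have hσ := ((contMDiffAt_hom_bundle _).1 (σ.contMDiff_toFun α₀.proj)).2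
    let c : M → F →L[ℝ] (F →L[ℝ] ℝ) := fun x => ContinuousLinearMap.inCoordinates F V
      (F →L[ℝ] ℝ) (fun x => V x →L[ℝ] ℝ) α₀.proj x α₀.proj x (σ.toFun x)
    have hc : ContMDiffAt I 𝓘(ℝ, F →L[ℝ] (F →L[ℝ] ℝ)) ∞ c α₀.proj := hσ
    have hmem : ∀ x ∈ (trivializationAt F V α₀.proj).baseSet,
        x ∈ (trivializationAt (F →L[ℝ] ℝ) (fun x => V x →L[ℝ] ℝ) α₀.proj).baseSet := by
      intro x hx
      rw [hom_trivializationAt_baseSet]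
      exact ⟨hx, by simp⟩
    have hx₀ : α₀.proj ∈ (trivializationAt F V α₀.proj).baseSet :=
      FiberBundle.mem_baseSet_trivializationAt' α₀.proj
    have hinv : (c α₀.proj).IsInvertible := by
      simp only [c]
      rw [ContinuousLinearMap.inCoordinates_eq hx₀ (hmem _ hx₀),
        ContinuousLinearMap.isInvertible_equiv_comp, ContinuousLinearMap.isInvertible_comp_equiv]
      exact σ.isInvertible _
    have hc' : ContMDiffAt I 𝓘(ℝ, (F →L[ℝ] ℝ) →L[ℝ] F) ∞ (fun x => (c x).inverse) α₀.proj :=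
      hinv.contDiffAt_map_inverse.contMDiffAt.comp α₀.proj hc
    have hp : ContMDiffAt (I.prod 𝓘(ℝ, F →L[ℝ] ℝ)) I ∞
        (fun α : TotalSpace (F →L[ℝ] ℝ) (fun x => V x →L[ℝ] ℝ) => α.proj) α₀ :=
      contMDiffAt_proj _
    have hid : ContMDiffAt (I.prod 𝓘(ℝ, F →L[ℝ] ℝ)) (I.prod 𝓘(ℝ, F →L[ℝ] ℝ)) ∞
        (fun α : TotalSpace (F →L[ℝ] ℝ) (fun x => V x →L[ℝ] ℝ) =>
          (⟨α.proj, α.snd⟩ : TotalSpace (F →L[ℝ] ℝ) (fun x => V x →L[ℝ] ℝ))) α₀ :=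
      contMDiffAt_id
    refine ContMDiffAt.clm_apply_of_inCoordinates
      (F₁ := F →L[ℝ] ℝ) (E₁ := fun x => V x →L[ℝ] ℝ) (F₂ := F) (E₂ := V)
      (b₁ := TotalSpace.proj) (b₂ := TotalSpace.proj)
      (v := fun α => α.snd) (ϕ := fun α => (σ.toFun α.proj).inverse) ?_ hid hp
    refine (hc'.comp α₀ hp).congr_of_eventuallyEq ?_
    have hU : ∀ᶠ α in nhds α₀, α.proj ∈ (trivializationAt F V α₀.proj).baseSet :=
      hp.continuousAt.eventually ((trivializationAt F V α₀.proj).open_baseSet.mem_nhds hx₀)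
    filter_upwards [hU] with α hα
    simp only [c, Function.comp]
    rw [ContinuousLinearMap.inCoordinates_eq hα (hmem _ hα),
      ContinuousLinearMap.inCoordinates_eq (hmem _ hα) hα,
      ContinuousLinearMap.inverse_equiv_comp, ContinuousLinearMap.inverse_comp_equiv]
    rfl

theorem NondegTwoForm.inv_sharp_flat (σ : NondegTwoForm I F V) (x : M) (v : V x) :
    σ.inv.sharp x (σ.toFun x v) = v :=
  (σ.isInvertible x).inverse_apply_self v

theorem NondegTwoForm.flat_inv_sharp (σ : NondegTwoForm I F V) (x : M) (α : V x →L[ℝ] ℝ) :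
    σ.toFun x (σ.inv.sharp x α) = α :=
  (σ.isInvertible x).self_apply_inverse α

/-- The bundle endomorphism `π^♯ ∘ σ^♭`. -/
def sharpFlat (P : Bivector I F V) (σ : TwoForm I F V) : BundleEnd I F V where
  toFun x := P.sharp x ∘L σ.toFun x
  contMDiff_toFun := by
    have h : ContMDiff (I.prod 𝓘(ℝ, F)) (I.prod 𝓘(ℝ, F →L[ℝ] ℝ)) ∞
        (fun v : TotalSpace F V => (⟨v.proj, σ.toFun v.proj v.snd⟩ :
          TotalSpace (F →L[ℝ] ℝ) (fun x => V x →L[ℝ] ℝ))) :=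
      (σ.contMDiff_toFun.comp (contMDiff_proj V)).clm_bundle_apply contMDiff_id
    exact P.contMDiff_sharp.comp h

/-- The transition morphisms `N_i = π_{i-1}^♯ ∘ σ_{i+1}^♭`, with indices in `ℤ/3ℤ`
(the class of `3` is `0`). -/
def transition (σ : ZMod 3 → NondegTwoForm I F V) (i : ZMod 3) : BundleEnd I F V :=
  sharpFlat (σ (i - 1)).inv (σ (i + 1)).toTwoForm

variable [IsManifold I ∞ M]

/-- `ε`-hypersymplectic structures with torsion: `N_i² = ε_i id` and
`ε_2 N_1 dσ_1 = ε_3 N_2 dσ_2 = ε_1 N_3 dσ_3`, where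
`(N_i dσ_i)(X, Y, Z) = dσ_i(N_i X, N_i Y, N_i Z)`. -/
structure IsEpsHST (A : LieAlgebroid I F V) (ε : ZMod 3 → ℝ)
    (σ : ZMod 3 → NondegTwoForm I F V) : Prop where
  sign : ∀ i, ε i = 1 ∨ ε i = -1
  sq : ∀ i x v, (transition σ i).toFun x ((transition σ i).toFun x v) = ε i • v
  torsion : ∀ i j X Y Z x,
    ε (i + 1) * (σ i).d A ((transition σ i).onSection X) ((transition σ i).onSection Y)
        ((transition σ i).onSection Z) x =
      ε (j + 1) * (σ j).d A ((transition σ j).onSection X) ((transition σ j).onSection Y)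
        ((transition σ j).onSection Z) x

/-- Hypersymplectic structures with torsion: `ε_1 = ε_2 = ε_3 = -1`. -/
def IsHypersymplecticWithTorsion (A : LieAlgebroid I F V)
    (σ : ZMod 3 → NondegTwoForm I F V) : Prop :=
  IsEpsHST A (fun _ => -1) σ

/-- Para-hypersymplectic structures with torsion: `ε_1 ε_2 ε_3 = -1`, but not all `ε_i` are
equal to `-1`. -/
def IsParaHypersymplecticWithTorsion (A : LieAlgebroid I F V)
    (σ : ZMod 3 → NondegTwoForm I F V) : Prop :=
  ∃ ε : ZMod 3 → ℝ, ε 1 * ε 2 * ε 3 = -1 ∧ ε ≠ (fun _ => -1) ∧ IsEpsHST A ε σ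

end Forms

end

end HSTorsion

/-!
The forms and the transition morphisms are related by `σ (i + 1) = σ (i - 1) (N i ·, ·)`, and going
once around the cycle gives `N (i - 1) ∘ N (i + 1) ∘ N i = id`. With `N i ² = ε i` this yields
quaternion-like relations, in particular `N (i + 1) ∘ N i = ε (i - 1) N (i - 1)` and
`N (i - 1) ∘ N i = -ε (i + 1) N (i + 1)`.

Fix `i`, and write `N = N i`, `ω = σ (i - 1)`, `ω' = σ (i + 1) = ω (N ·, ·)`. If `T` is the Nijenhuis
torsion of `N`, then expanding the differentials gives (`d_torsion_identity`)
`-ω (T (X, Y), Z) = dω (N X, N Y, Z) - dω' (N X, Y, Z) - dω' (X, N Y, Z) + ε i dω (X, Y, Z)`.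
By hypothesis, each `d(σ j)` is up to sign `c (N j ·, N j ·, N j ·)` for one and the same `c`, skew in
its last two arguments. Substituting this and the quaternionic relations, the right-hand side
becomes skew in `Y` and `Z` (`apply_torsion_swap`).

On the other hand, `N² = ε i` alone gives `T (N X, Y) = T (X, N Y) = -N T (X, Y)`, and `N` is
symmetric with respect to `ω`. With the skewness of `ω (T (X, Y), Z)` in `Y` and `Z`, these relations
force `ω (T (X, Y), N Z) = 0`, so `T = 0` since `N` is invertible and `ω` is non-degenerate; that
every vector is the value of a section comes from a bump function (`exists_section_eq`).
-/

namespace HSTorsion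

set_option linter.unusedSectionVars false

section

variable {E : Type*} [NormedAddCommGroup E] [NormedSpace ℝ E]
  {H : Type*} [TopologicalSpace H] {I : ModelWithCorners ℝ E H}
  {M : Type*} [TopologicalSpace M] [ChartedSpace H M]
  {F : Type*} [NormedAddCommGroup F] [NormedSpace ℝ F]
  {V : M → Type*} [TopologicalSpace (TotalSpace F V)]
  [∀ x, AddCommGroup (V x)] [∀ x, Module ℝ (V x)] [∀ x, TopologicalSpace (V x)]
  [FiberBundle F V] [VectorBundle ℝ F V]

/-! ### Sections and bundle endomorphisms -/

/-- Every vector of a smooth vector bundle is the value of a global smooth section. -/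
theorem exists_section_eq [FiniteDimensional ℝ E] [T2Space M] [IsManifold I ∞ M]
    [ContMDiffVectorBundle ∞ F V I] (x : M) (v : V x) : ∃ X : Cₛ^∞⟮I; F, V⟯, X x = v := by
  obtain ⟨s, hs, hv⟩ := FiberBundle.exists_contMDiffOn_extend (k := ∞) I F v
  obtain ⟨u, hus, hu, hxu⟩ := mem_nhds_iff.1 hs
  obtain ⟨f, -, hf⟩ := (SmoothBumpFunction.nhds_basis_tsupport (I := I) x).mem_iff.1
    (hu.mem_nhds hxu)
  refine ⟨⟨fun y => f y • FiberBundle.extend F v y,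
    ContMDiffOn.smul_section_of_tsupport f.contMDiff.contMDiffOn hu hf (hv.mono hus)⟩, ?_⟩
  simp [ContMDiffSection.coeFn_mk]

namespace BundleEnd

@[simp]
theorem onSection_apply (N : BundleEnd I F V) (X : Cₛ^∞⟮I; F, V⟯) (x : M) :
    N.onSection X x = N.toFun x (X x) := rfl

theorem onSection_add (N : BundleEnd I F V) (X Y : Cₛ^∞⟮I; F, V⟯) :
    N.onSection (X + Y) = N.onSection X + N.onSection Y := by
  ext x; simp

theorem onSection_sub (N : BundleEnd I F V) (X Y : Cₛ^∞⟮I; F, V⟯) :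
    N.onSection (X - Y) = N.onSection X - N.onSection Y := by
  ext x; simp

theorem onSection_smul (N : BundleEnd I F V) (a : ℝ) (X : Cₛ^∞⟮I; F, V⟯) :
    N.onSection (a • X) = a • N.onSection X := by
  ext x; simp

end BundleEnd

namespace LieAlgebroid

variable [IsManifold I ∞ M]

theorem bracket_swap (A : LieAlgebroid I F V) (X Y : Cₛ^∞⟮I; F, V⟯) :
    A.bracket Y X = -A.bracket X Y := by
  have h := A.bracket_self (X + Y)
  simp only [map_add, LinearMap.add_apply, A.bracket_self, zero_add, add_zero] at h
  exact eq_neg_of_add_eq_zero_left h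

/-! ### The Nijenhuis torsion of an endomorphism with constant square -/

theorem torsion_onSection_left (A : LieAlgebroid I F V) {N : BundleEnd I F V} {e : ℝ}
    (hN : ∀ X, N.onSection (N.onSection X) = e • X) (X Y : Cₛ^∞⟮I; F, V⟯) :
    A.torsion N (N.onSection X) Y = -N.onSection (A.torsion N X Y) := by
  simp only [torsion, hN, N.onSection_add, N.onSection_sub, N.onSection_smul, map_smul,
    LinearMap.smul_apply]
  module

theorem torsion_onSection_right (A : LieAlgebroid I F V) {N : BundleEnd I F V} {e : ℝ}
    (hN : ∀ X, N.onSection (N.onSection X) = e • X) (X Y : Cₛ^∞⟮I; F, V⟯) :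
    A.torsion N X (N.onSection Y) = -N.onSection (A.torsion N X Y) := by
  simp only [torsion, hN, N.onSection_add, N.onSection_sub, N.onSection_smul, map_smul]
  module

/-! ### The differential of a 2-form -/

theorem deriv_smul_left (A : LieAlgebroid I F V) (a : ℝ) (X : Cₛ^∞⟮I; F, V⟯) (f : M → ℝ) (x : M) :
    A.deriv (a • X) f x = a * A.deriv X f x := by
  simp only [deriv, ContMDiffSection.coe_smul, Pi.smul_apply, map_smul]
  rfl

theorem deriv_neg (A : LieAlgebroid I F V) (X : Cₛ^∞⟮I; F, V⟯) (f : M → ℝ) (x : M) :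
    A.deriv X (fun y => -f y) x = -A.deriv X f x := by
  have h : mfderiv I 𝓘(ℝ, ℝ) (fun y => -f y) x = -mfderiv I 𝓘(ℝ, ℝ) f x :=
    mfderiv_neg (f := f)
  simp only [deriv, h]
  rfl

theorem deriv_const_mul (A : LieAlgebroid I F V) (X : Cₛ^∞⟮I; F, V⟯) (a : ℝ) {f : M → ℝ} {x : M}
    (hf : MDifferentiableAt I 𝓘(ℝ, ℝ) f x) :
    A.deriv X (fun y => a * f y) x = a * A.deriv X f x := by
  have h : mfderiv I 𝓘(ℝ, ℝ) (fun y => a * f y) x = a • mfderiv I 𝓘(ℝ, ℝ) f x :=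
    const_smul_mfderiv hf a
  simp only [deriv, h]
  rfl

end LieAlgebroid

namespace TwoForm

variable [∀ x, IsTopologicalAddGroup (V x)] [∀ x, ContinuousSMul ℝ (V x)]

theorem mdifferentiableAt_apply (σ : TwoForm I F V) (X Y : Cₛ^∞⟮I; F, V⟯) (x : M) :
    MDifferentiableAt I 𝓘(ℝ, ℝ) (fun y => σ.toFun y (X y) (Y y)) x := by
  have h : ContMDiff I (I.prod 𝓘(ℝ, ℝ)) ∞
      (fun y => TotalSpace.mk' ℝ (E := Bundle.Trivial M ℝ) y (σ.toFun y (X y) (Y y))) :=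
    ContMDiff.clm_bundle_apply₂ (F₁ := F) (F₂ := F) (F₃ := ℝ)
      (E₁ := V) (E₂ := V) (E₃ := Bundle.Trivial M ℝ) (b := fun y => y)
      σ.contMDiff_toFun X.contMDiff Y.contMDiff
  exact ((contMDiffAt_section (E := Bundle.Trivial M ℝ) x).1 (h x)).mdifferentiableAt (by simp)

variable [IsManifold I ∞ M]

theorem d_swap_right (A : LieAlgebroid I F V) (σ : TwoForm I F V) (X Y Z : Cₛ^∞⟮I; F, V⟯) (x : M) :
    σ.d A X Z Y x = -σ.d A X Y Z x := by
  have h : (fun y => σ.toFun y (Z y) (Y y)) = fun y => -σ.toFun y (Y y) (Z y) :=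
    funext fun y => σ.skew y _ _
  simp only [d, h, A.deriv_neg, A.bracket_swap Y Z, ContMDiffSection.coe_neg, Pi.neg_apply, map_neg,
    neg_apply]
  ring

theorem d_smul (A : LieAlgebroid I F V) (σ : TwoForm I F V) (a b c : ℝ) (X Y Z : Cₛ^∞⟮I; F, V⟯)
    (x : M) : σ.d A (a • X) (b • Y) (c • Z) x = a * b * c * σ.d A X Y Z x := by
  have h : ∀ (s t : ℝ) (P U W : Cₛ^∞⟮I; F, V⟯),
      A.deriv P (fun y => σ.toFun y ((s • U) y) ((t • W) y)) x =
        s * t * A.deriv P (fun y => σ.toFun y (U y) (W y)) x := by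
    intro s t P U W
    rw [← A.deriv_const_mul _ _ (σ.mdifferentiableAt_apply _ _ x)]
    congr 1
    ext y
    simp only [ContMDiffSection.coe_smul, Pi.smul_apply, map_smul, smul_apply, smul_eq_mul]
    ring
  simp only [d, h, A.deriv_smul_left]
  simp only [map_smul, LinearMap.smul_apply, ContMDiffSection.coe_smul, Pi.smul_apply,
    smul_apply, smul_eq_mul]
  ring

/-- If `τ = σ (N ·, ·)` and `N² = e`, then the differentials of `σ` and `τ` determine the Nijenhuis
torsion of `N`, contracted with `σ`. -/
theorem d_torsion_identity (A : LieAlgebroid I F V) {σ τ : TwoForm I F V} {N : BundleEnd I F V}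
    {e : ℝ} (hN : ∀ X, N.onSection (N.onSection X) = e • X)
    (hτ : ∀ x v w, τ.toFun x v w = σ.toFun x (N.toFun x v) w) (X Y Z : Cₛ^∞⟮I; F, V⟯) (x : M) :
    σ.d A (N.onSection X) (N.onSection Y) Z x - τ.d A (N.onSection X) Y Z x
        - τ.d A X (N.onSection Y) Z x + e * σ.d A X Y Z x =
      -σ.toFun x (A.torsion N X Y x) (Z x) := by
  have hsymm : ∀ y v w, σ.toFun y v (N.toFun y w) = σ.toFun y (N.toFun y v) w := by
    intro y v w
    rw [σ.skew, ← hτ, ← hτ, τ.skew, neg_neg]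
  have hNN : ∀ (U : Cₛ^∞⟮I; F, V⟯) y, N.toFun y (N.toFun y (U y)) = e • U y := by
    intro U y
    simpa using congrArg (fun W : Cₛ^∞⟮I; F, V⟯ => W y) (hN U)
  simp only [d, LieAlgebroid.torsion, hτ, hsymm, hNN, BundleEnd.onSection_apply, map_smul,
    map_add, map_sub, add_apply, sub_apply,
    smul_apply, smul_eq_mul, ContMDiffSection.coe_add, ContMDiffSection.coe_sub,
    Pi.add_apply, Pi.sub_apply, A.deriv_const_mul _ _ (σ.mdifferentiableAt_apply _ _ x)]
  ring

end TwoForm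

/-! ### The transition morphisms -/

section Transition

variable [∀ x, IsTopologicalAddGroup (V x)] [∀ x, ContinuousSMul ℝ (V x)]
  [FiniteDimensional ℝ F] [ContMDiffVectorBundle ∞ F V I]

theorem apply_eq_apply_transition (σ : ZMod 3 → NondegTwoForm I F V) {i j k : ZMod 3}
    (hj : j = i + 1) (hk : k = i - 1) (x : M) (v w : V x) :
    (σ j).toFun x v w = (σ k).toFun x ((transition σ i).toFun x v) w := by
  subst hj hk
  have h : (σ (i - 1)).toFun x ((transition σ i).toFun x v) = (σ (i + 1)).toFun x v :=
    (σ (i - 1)).flat_inv_sharp x _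
  rw [h]

/-- Composing the three transition morphisms around the cycle gives the identity. -/
theorem transition_cycle (σ : ZMod 3 → NondegTwoForm I F V) (i : ZMod 3) (x : M) (v : V x) :
    (transition σ (i - 1)).toFun x ((transition σ (i + 1)).toFun x ((transition σ i).toFun x v)) =
      v := by
  rw [← sub_eq_zero]
  refine (σ (i + 1)).nondeg x _ fun w => ?_
  have h1 : i - 1 = i + 1 + 1 := by revert i; decide
  have h2 : i = i + 1 - 1 := by ring
  have h3 : i = i - 1 + 1 := by ring
  have h4 : i + 1 = i - 1 - 1 := by revert i; decide
  rw [map_sub, sub_apply, sub_eq_zero,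
    ← apply_eq_apply_transition σ h3 h4, ← apply_eq_apply_transition σ h1 h2,
    ← apply_eq_apply_transition σ rfl rfl]

variable [IsManifold I ∞ M]

namespace IsEpsHST

variable {A : LieAlgebroid I F V} {ε : ZMod 3 → ℝ} {σ : ZMod 3 → NondegTwoForm I F V}

theorem sign_mul_self (h : IsEpsHST A ε σ) (i : ZMod 3) : ε i * ε i = 1 := by
  rcases h.sign i with h | h <;> norm_num [h]

theorem sign_prod (hε : ε 1 * ε 2 * ε 3 = -1) (i : ZMod 3) :
    ε i * ε (i + 1) * ε (i - 1) = -1 := by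
  have h : ∀ i : ZMod 3, (i = 1 ∧ i + 1 = 2 ∧ i - 1 = 3) ∨ (i = 2 ∧ i + 1 = 3 ∧ i - 1 = 1) ∨
      (i = 3 ∧ i + 1 = 1 ∧ i - 1 = 2) := by decide
  rcases h i with ⟨h1, h2, h3⟩ | ⟨h1, h2, h3⟩ | ⟨h1, h2, h3⟩ <;> rw [h2, h3, h1] <;> linarith

theorem onSection_onSection (h : IsEpsHST A ε σ) (i : ZMod 3) (X : Cₛ^∞⟮I; F, V⟯) :
    (transition σ i).onSection ((transition σ i).onSection X) = ε i • X := by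
  ext x
  exact h.sq i x (X x)

theorem transition_succ (h : IsEpsHST A ε σ) (i : ZMod 3) (x : M) (v : V x) :
    (transition σ (i + 1)).toFun x ((transition σ i).toFun x v) =
      ε (i - 1) • (transition σ (i - 1)).toFun x v := by
  have h1 := congrArg ((transition σ (i - 1)).toFun x) (transition_cycle σ i x v)
  rw [h.sq] at h1
  rw [← h1, smul_smul, h.sign_mul_self, one_smul]

theorem transition_pred (h : IsEpsHST A ε σ) (hε : ε 1 * ε 2 * ε 3 = -1) (i : ZMod 3) (x : M)
    (v : V x) :
    (transition σ (i - 1)).toFun x ((transition σ i).toFun x v) =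
      -ε (i + 1) • (transition σ (i + 1)).toFun x v := by
  have h4 : i - 1 - 1 = i + 1 := by clear * -; revert i; decide
  have h1 := h.transition_succ (i - 1) x
    ((transition σ (i - 1)).toFun x ((transition σ i).toFun x v))
  rw [sub_add_cancel, h4, h.sq, map_smul, h.sq, smul_smul] at h1
  have h2 := congrArg ((transition σ (i + 1)).toFun x) h1
  rw [map_smul, map_smul, h.sq, smul_smul, h.sign_mul_self, one_smul] at h2
  rw [← h2]
  congr 1
  linear_combination ε (i + 1) * sign_prod hε i - ε i * ε (i - 1) * h.sign_mul_self (i + 1)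

/-! ### The torsion of the transition morphisms -/

/-- Up to sign, every `d(σ j)` is the pullback under `N j` of one trilinear map, which can be
expressed through `d(σ k)` for any fixed `k`. -/
theorem d_eq (h : IsEpsHST A ε σ) (j k : ZMod 3) (X Y Z : Cₛ^∞⟮I; F, V⟯) (x : M) :
    (σ j).d A X Y Z x = ε j * ε (j + 1) *
      (ε (k + 1) * (σ k).d A
        ((transition σ k).onSection ((transition σ j).onSection X))
        ((transition σ k).onSection ((transition σ j).onSection Y))
        ((transition σ k).onSection ((transition σ j).onSection Z)) x) := by
  rw [← h.torsion j k, h.onSection_onSection, h.onSection_onSection, h.onSection_onSection,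
    TwoForm.d_smul]
  have h1 := h.sign_mul_self j
  have h2 := h.sign_mul_self (j + 1)
  linear_combination -(σ j).d A X Y Z x *
    ((ε j * ε j + 1) * (ε (j + 1) * ε (j + 1)) * h1 + h2)

/-- Contracting the torsion of `transition σ i` with `σ (i - 1)` gives a trilinear map that is skew in
its last two arguments. -/
theorem apply_torsion_swap (h : IsEpsHST A ε σ) (hε : ε 1 * ε 2 * ε 3 = -1) (i : ZMod 3)
    (X Y Z : Cₛ^∞⟮I; F, V⟯) (x : M) :
    (σ (i - 1)).toFun x (A.torsion (transition σ i) X Z x) (Y x) =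
      -(σ (i - 1)).toFun x (A.torsion (transition σ i) X Y x) (Z x) := by
  have hT := TwoForm.d_torsion_identity A (σ := (σ (i - 1)).toTwoForm)
    (τ := (σ (i + 1)).toTwoForm) (h.onSection_onSection i) (apply_eq_apply_transition σ rfl rfl)
  have hsucc : ∀ U : Cₛ^∞⟮I; F, V⟯,
      (transition σ (i + 1)).onSection ((transition σ i).onSection U) =
        ε (i - 1) • (transition σ (i - 1)).onSection U :=
    fun U => ContMDiffSection.ext fun y => h.transition_succ i y (U y)
  have hpred : ∀ U : Cₛ^∞⟮I; F, V⟯,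
      (transition σ (i - 1)).onSection ((transition σ i).onSection U) =
        -ε (i + 1) • (transition σ (i + 1)).onSection U :=
    fun U => ContMDiffSection.ext fun y => h.transition_pred hε i y (U y)
  obtain ⟨C, hC, hsmul, hswap⟩ : ∃ C : (X Y Z : Cₛ^∞⟮I; F, V⟯) → ℝ,
      (∀ j X Y Z, (σ j).d A X Y Z x = ε j * ε (j + 1) *
        C ((transition σ j).onSection X) ((transition σ j).onSection Y)
          ((transition σ j).onSection Z)) ∧
      (∀ (a b c : ℝ) X Y Z, C (a • X) (b • Y) (c • Z) = a * b * c * C X Y Z) ∧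
      ∀ X Y Z, C X Z Y = -C X Y Z := by
    refine ⟨fun X Y Z => ε (i + 1) * (σ i).d A ((transition σ i).onSection X)
      ((transition σ i).onSection Y) ((transition σ i).onSection Z) x,
      fun j X Y Z => h.d_eq j i X Y Z x, fun a b c X Y Z => ?_, fun X Y Z => ?_⟩
    · simp only [BundleEnd.onSection_smul, TwoForm.d_smul]
      ring
    · simp only [TwoForm.d_swap_right A _ _ ((transition σ i).onSection Y)]
      ring
  have hsmul₁ : ∀ (a : ℝ) X Y Z, C (a • X) Y Z = a * C X Y Z := fun a X Y Z => by
    simpa using hsmul a 1 1 X Y Z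
  have hsmul₂ : ∀ (a : ℝ) X Y Z, C X (a • Y) Z = a * C X Y Z := fun a X Y Z => by
    simpa using hsmul 1 a 1 X Y Z
  have hi : i - 1 + 1 = i := sub_add_cancel i 1
  have hi' : i + 1 + 1 = i - 1 := by clear * -; revert i; decide
  have hY := hT X Y Z x
  have hZ := hT X Z Y x
  simp only [hC, hsucc, hpred, hsmul₁, hsmul₂, hi, hi'] at hY hZ
  rw [hswap _ ((transition σ (i - 1)).onSection Y) ((transition σ (i + 1)).onSection Z),
    hswap _ ((transition σ (i + 1)).onSection Y) ((transition σ (i + 1)).onSection Z),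
    hswap _ ((transition σ (i + 1)).onSection Y) ((transition σ (i - 1)).onSection Z),
    hswap _ ((transition σ (i - 1)).onSection Y) ((transition σ (i - 1)).onSection Z)] at hZ
  -- The three mixed terms of `hY` have the same coefficient; exchanging `Y` and `Z` permutes them.
  have hc : ε (i - 1) * ε i * (-ε (i + 1)) * (-ε (i + 1)) =
      -(ε (i + 1) * ε (i - 1) * ε (i - 1)) := by
    linear_combination ε (i + 1) * sign_prod hε i + ε (i + 1) * h.sign_mul_self (i - 1)
  linear_combination hY + hZ - hc * (C ((transition σ (i + 1)).onSection X)
      ((transition σ (i + 1)).onSection Y) ((transition σ (i - 1)).onSection Z) -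
    C ((transition σ (i + 1)).onSection X)
      ((transition σ (i - 1)).onSection Y) ((transition σ (i + 1)).onSection Z))

theorem isNijenhuis_transition [FiniteDimensional ℝ E] [T2Space M] (h : IsEpsHST A ε σ)
    (hε : ε 1 * ε 2 * ε 3 = -1) (i : ZMod 3) : A.IsNijenhuis (transition σ i) := by
  have hN := h.onSection_onSection i
  intro X Y
  ext x
  have hswap := fun X Y Z => h.apply_torsion_swap hε i X Y Z x
  have hsymm : ∀ v w, (σ (i - 1)).toFun x v ((transition σ i).toFun x w) =
      (σ (i - 1)).toFun x ((transition σ i).toFun x v) w := by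
    intro v w
    rw [(σ (i - 1)).skew, ← apply_eq_apply_transition σ rfl rfl,
      ← apply_eq_apply_transition σ rfl rfl, (σ (i + 1)).skew, neg_neg]
  have hleft : ∀ X Y Z : Cₛ^∞⟮I; F, V⟯,
      (σ (i - 1)).toFun x (A.torsion (transition σ i) ((transition σ i).onSection X) Y x) (Z x) =
        -(σ (i - 1)).toFun x (A.torsion (transition σ i) X Y x)
          ((transition σ i).toFun x (Z x)) := by
    intro X Y Z
    rw [A.torsion_onSection_left hN, hsymm]
    simp
  have hright : ∀ X Y Z : Cₛ^∞⟮I; F, V⟯,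
      (σ (i - 1)).toFun x (A.torsion (transition σ i) X ((transition σ i).onSection Y) x) (Z x) =
        -(σ (i - 1)).toFun x (A.torsion (transition σ i) X Y x)
          ((transition σ i).toFun x (Z x)) := by
    intro X Y Z
    rw [A.torsion_onSection_right hN, hsymm]
    simp
  refine (σ (i - 1)).nondeg x _ fun w => ?_
  -- `Z` is chosen with `N Z = w` at `x`.
  obtain ⟨Z, hZ⟩ := exists_section_eq (I := I) (F := F) x (ε i • (transition σ i).toFun x w)
  have hw : (transition σ i).toFun x (Z x) = w := by
    rw [hZ, map_smul, h.sq, smul_smul, h.sign_mul_self, one_smul]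
  -- With `g (X, Y, Z) = ω (T (X, Y), Z)`, these relations give `g (X, Y, N Z) = -g (N X, Y, Z)
  -- = g (N X, Z, Y) = -g (X, Z, N Y) = g (X, N Y, Z) = -g (X, Y, N Z)`.
  have h1 := hleft X Y Z
  have h2 := hswap ((transition σ i).onSection X) Z Y
  have h3 := hleft X Z Y
  have h4 := hswap X ((transition σ i).onSection Y) Z
  have h5 := hright X Y Z
  rw [BundleEnd.onSection_apply] at h4
  rw [hw] at h1 h5
  linarith

end IsEpsHST

end Transition

end

end HSTorsion

theorem mainTheorem3
    {E : Type*} [NormedAddCommGroup E] [NormedSpace ℝ E] [FiniteDimensional ℝ E]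
    {H : Type*} [TopologicalSpace H] {I : ModelWithCorners ℝ E H}
    {M : Type*} [TopologicalSpace M] [ChartedSpace H M] [IsManifold I ∞ M]
    [T2Space M]
    {F : Type*} [NormedAddCommGroup F] [NormedSpace ℝ F] [FiniteDimensional ℝ F]
    {V : M → Type*} [TopologicalSpace (TotalSpace F V)]
    [∀ x, AddCommGroup (V x)] [∀ x, Module ℝ (V x)] [∀ x, TopologicalSpace (V x)]
    [∀ x, IsTopologicalAddGroup (V x)] [∀ x, ContinuousSMul ℝ (V x)]
    [FiberBundle F V] [VectorBundle ℝ F V] [ContMDiffVectorBundle ∞ F V I]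
    (A : HSTorsion.LieAlgebroid I F V) (σ : ZMod 3 → HSTorsion.NondegTwoForm I F V)
    (hσ : HSTorsion.IsHypersymplecticWithTorsion A σ ∨
      HSTorsion.IsParaHypersymplecticWithTorsion A σ) :
    ∀ i : ZMod 3, A.IsNijenhuis (HSTorsion.transition σ i) := by 
  obtain h | ⟨ε, hε, -, h⟩ := hσ
  · exact h.isNijenhuis_transition (by norm_num)
  · exact h.isNijenhuis_transition hε
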